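/- Let $n,k,d$ be integers with $1\le k\le n$ and $1\le d\le n-1$, and let $\alpha,\beta\ge 0$ be real numbers. **Family repair (FR) scheme.** Sort the $n$ storage nodes in an arbitrary order and number them $1,\dots,n$. Put $c=\lfloor n/(n-d)\rfloor$. For $b=1,\dots,c$ the nodes $(b-1)(n-d)+1,\dots,b(n-d)$ form the $b$-th complete family; the remaining $n\bmod(n-d)$ nodes form the incomplete family. The helper set $D_i$ of a node $i$ of a complete family consists of all nodes outside the family of $i$; for a node $i$ of the incomplete family, $D_i=\{1,\dots,d\}$. In all cases $|D_i|=d$ and $i\notin D_i$. **Information flow graphs (IFGs).** For a finite sequence of single-node failures (repeated failures of a node are allowed), the corresponding IFG $G$ has a source $s$, one pair of vertices $x_{\mathrm{in}},x_{\mathrm{out}}$ for each of the $n$ initial storage nodes and for each newcomer, and an edge of capacity $\alpha$ from $x_{\mathrm{in}}$ to $x_{\mathrm{out}}$ for each of them. There are edges of infinite capacity from $s$ to $x_{\mathrm{in}}$ for each initial node $x$. When node $i$ fails it becomes inactive and is replaced by a newcomer, which is from then on the active copy of node $i$ and whose input vertex receives an edge of capacity $\beta$ from the output vertex of the currently active copy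 of each node in $D_i$. Finally, for each choice of $k$ of the $n$ active nodes at the end there is a data collector $t$, which receives edges of infinite capacity from the output vertices of these $k$ nodes. Let $\mathcal G_F$ be the set of all IFGs that arise in this way from the FR scheme $F$ over all finite failure sequences, let $\mathrm{DC}(G)$ be the set of the $\binom nk$ data collectors of $G$, and let $\operatorname{mincut}_G(s,t)$ be the minimum capacity of a cut separating $s$ from $t$ in $G$. **Family index permutations.** The family index vector is the vector of length $n$ whose $i$-th entry is $b$ if node $i$ belongs to the $b$-th complete family, except that it is $-c$ if $i$ belongs to the $c$-th (last) complete family and $i>d$, and whose $i$-th entry is $0$ if node $i$ belongs to the incomplete family. A family index permutation $\pi_f$ is any rearrangement of this vector. If the $i$-th coordinate of $\pi_f$ is $0$, let $y_i(\pi_f)$ be the number of $j<i$ such that the $j$-th coordinate of $\pi_f$ is positive; otherwise let $y_i(\pi_f)$ be the number of $j<i$ such that the $j$-th and $i$-th coordinates of $\pi_f$ have different absolute values. **Proposition.** For every FR scheme $F$, the following two minima are attained, and $$\min_{G\in\mathcal G_F}\ \min_{t\in\mathrm{DC}(G)}\operatorname{mincut}_G(s,t)\;=\;\min_{\pi_f}\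 \sum_{i=1}^{k}\min\bigl((d-y_i(\pi_f))\beta,\ \alpha\bigr),$$ where $\pi_f$ ranges over all family index permutations. -/

import Mathlib

open scoped NNReal ENNReal

/-! ### Capacitated directed graphs and minimum cuts -/

/-- A directed graph on the vertex set `V` with nonnegative, possibly infinite, edge capacities.
A pair of capacity `0` is a pair not joined by an edge. -/
structure FlowNetwork (V : Type*) where
  /-- The capacity of the edge from the first vertex to the second. -/
  cap : V → V → ℝ≥0∞

namespace FlowNetwork

variable {V : Type*} [Fintype V] [DecidableEq V]

/-- The value of the cut `(U, Uᶜ)`: the total capacity of the edges leaving `U`. -/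
noncomputable def cutValue (N : FlowNetwork V) (U : Finset V) : ℝ≥0∞ :=
  ∑ u ∈ U, ∑ v ∈ Uᶜ, N.cap u v

/-- The minimum cut value separating `t` from `s`. -/
noncomputable def minCut (N : FlowNetwork V) (s t : V) : ℝ≥0∞ :=
  ⨅ U : {U : Finset V // s ∈ U ∧ t ∉ U}, N.cutValue U.1

end FlowNetwork

/-! ### Stationary repair schemes -/

/-- A stationary repair scheme for `n` nodes with `d` helpers per repair: whenever node `i` fails,
its replacement contacts the `d` nodes in `helpers i`. -/
structure StationaryScheme (n d : ℕ) where
  /-- The helper set of each node. -/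
  helpers : Fin n → Finset (Fin n)
  card_helpers : ∀ i, (helpers i).card = d
  notMem_helpers : ∀ i, i ∉ helpers i

/-! ### Information flow graphs

A failure history is a finite sequence `f : Fin T → Fin n`: at time `j` node `f j` fails and is
replaced. The storage nodes of the graph are the `n` initial ones, `Sum.inl i`, and the `T`
newcomers, `Sum.inr j`; each of them is split into an input and an output vertex. -/

/-- The vertices of an information flow graph with `n` initial storage nodes, `T` newcomers and one
data collector for each choice of `k` of the `n` active nodes. -/
inductive IFGVertex (n k T : ℕ) : Type
  | source : IFGVertex n k T
  | inp (x : Fin n ⊕ Fin T) : IFGVertex n k T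
  | out (x : Fin n ⊕ Fin T) : IFGVertex n k T
  | collector (S : {S : Finset (Fin n) // S.card = k}) : IFGVertex n k T
  deriving DecidableEq, Fintype

/-- The storage node of the graph that plays the role of node `i` after the first `t` repairs: the
newcomer of the latest repair of node `i`, or the initial one if node `i` has not failed yet. -/
def activeNode {n T : ℕ} (f : Fin T → Fin n) : (t : ℕ) → t ≤ T → Fin n → Fin n ⊕ Fin T
  | 0, _, i => Sum.inl i
  | t + 1, h, i =>
      if f ⟨t, h⟩ = i then Sum.inr ⟨t, h⟩ else activeNode f t (Nat.le_of_succ_le h) i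

/-- The information flow graph of a stationary repair scheme `A` after the failure history `f`, with
storage `α` per node and `β` units of traffic per helper. -/
noncomputable def ifg {n d : ℕ} (A : StationaryScheme n d) (k : ℕ) (α β : ℝ≥0) {T : ℕ}
    (f : Fin T → Fin n) : FlowNetwork (IFGVertex n k T) where
  cap
    | .source, .inp (.inl _) => ⊤
    | .inp x, .out y => if x = y then (α : ℝ≥0∞) else 0
    | .out x, .inp (.inr j) =>
        if ∃ i ∈ A.helpers (f j), x = activeNode f j j.isLt.le i then (β : ℝ≥0∞) else 0
    | .out x, .collector S => if ∃ i ∈ S.1, x = activeNode f T le_rfl i then ⊤ else 0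
    | _, _ => 0

/-! ### The family repair scheme

Positions are numbered from `0`, so the blocks of `n - d` consecutive positions are the values of
`p / (n - d)`. The blocks `0, …, n / (n - d) - 1` are the complete families, and the remaining
`n % (n - d)` positions form the incomplete family. -/

/-- The helper positions of position `p`: everything outside the family of `p` if this family is
complete, and the first `d` positions if `p` is in the incomplete family. -/
def familyHelpers (n d : ℕ) (p : Fin n) : Finset (Fin n) :=
  if (p : ℕ) / (n - d) < n / (n - d) then
    Finset.univ.filter fun q : Fin n => (q : ℕ) / (n - d) ≠ (p : ℕ) / (n - d)
  else
    Finset.univ.filter fun q : Fin n => (q : ℕ) < d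

theorem card_familyHelpers {n d : ℕ} (hd : d < n) (p : Fin n) :
    (familyHelpers n d p).card = d := by
  have hm : 0 < n - d := by omega
  unfold familyHelpers
  split_ifs with h
  · have h1 : (Finset.univ.filter fun q : Fin n => (q : ℕ) / (n - d) = (p : ℕ) / (n - d)).card
        = n - d := by
      have h2 : ((Finset.univ.filter fun q : Fin n =>
          (q : ℕ) / (n - d) = (p : ℕ) / (n - d)).map Fin.valEmbedding)
          = Finset.Ico ((p : ℕ) / (n - d) * (n - d)) ((p : ℕ) / (n - d) * (n - d) + (n - d)) := by
        ext a
        have h3 : ((p : ℕ) / (n - d) + 1) * (n - d) ≤ n :=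
          (Nat.mul_le_mul_right _ h).trans (Nat.div_mul_le_self _ _)
        have h4 : a / (n - d) = (p : ℕ) / (n - d) ↔
            (p : ℕ) / (n - d) * (n - d) ≤ a ∧ a < (p : ℕ) / (n - d) * (n - d) + (n - d) := by
          rw [Nat.div_eq_iff hm]
          constructor <;> rintro ⟨h5, h6⟩ <;> constructor <;> omega
        rw [add_mul, one_mul] at h3
        simp only [Finset.mem_map, Finset.mem_filter, Finset.mem_univ, true_and,
          Fin.valEmbedding_apply, Finset.mem_Ico]
        constructor
        · rintro ⟨q, hq, rfl⟩
          exact h4.1 hq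
        · intro ha
          exact ⟨⟨a, by omega⟩, h4.2 ha, rfl⟩
      rw [← Finset.card_map Fin.valEmbedding, h2, Nat.card_Ico]
      omega
    have h5 := Finset.card_filter_add_card_filter_not (s := (Finset.univ : Finset (Fin n)))
      (fun q : Fin n => (q : ℕ) / (n - d) = (p : ℕ) / (n - d))
    rw [h1, Finset.card_univ, Fintype.card_fin] at h5
    simp only [ne_eq]
    omega
  · rw [Fin.card_filter_val_lt]
    omega

theorem notMem_familyHelpers {n d : ℕ} (hd : d < n) (p : Fin n) : p ∉ familyHelpers n d p := by
  have hm : 0 < n - d := by omega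
  unfold familyHelpers
  split_ifs with h
  · simp
  · have h1 : n < (n / (n - d) + 1) * (n - d) := by
      rw [mul_comm]; exact Nat.lt_mul_div_succ n hm
    have h2 : n / (n - d) * (n - d) ≤ (p : ℕ) := (Nat.le_div_iff_mul_le hm).1 (not_lt.1 h)
    rw [add_mul, one_mul] at h1
    simp only [Finset.mem_filter, Finset.mem_univ, true_and, not_lt]
    omega

/-- The family repair scheme in which the nodes are sorted by `σ`: node `i` has position `σ i`. -/
def familyRepair {n d : ℕ} (hd : d < n) (σ : Equiv.Perm (Fin n)) : StationaryScheme n d where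
  helpers i := (familyHelpers n d (σ i)).map σ.symm.toEmbedding
  card_helpers i := by rw [Finset.card_map, card_familyHelpers hd]
  notMem_helpers i := by
    intro h
    obtain ⟨q, hq, hqi⟩ := Finset.mem_map.1 h
    have hqi' : q = σ i := by rw [← hqi]; simp
    exact notMem_familyHelpers hd (σ i) (hqi' ▸ hq)

/-! ### Family index permutations -/

/-- The family index vector: with `c = n / (n - d)`, the entry of a member of the complete family
`b ∈ {1, …, c}` is `b`, except that it is `-c` for those members of the last complete family that
are not among the first `d` positions; the entry of a member of the incomplete family is `0`. -/
def familyIndexVector (n d : ℕ) (p : Fin n) : ℤ :=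
  if (p : ℕ) < d then (((p : ℕ) / (n - d) + 1 : ℕ) : ℤ)
  else if (p : ℕ) < n / (n - d) * (n - d) then -((n / (n - d) : ℕ) : ℤ)
  else 0

/-- A family index permutation is a rearrangement of the family index vector. -/
def IsFamilyIndexPermutation (n d : ℕ) (π : Fin n → ℤ) : Prop :=
  ∃ τ : Equiv.Perm (Fin n), π = familyIndexVector n d ∘ τ

/-- The number `y i` of a vector of family indices. -/
def yCount {n : ℕ} (π : Fin n → ℤ) (i : Fin n) : ℕ :=
  if π i = 0 then (Finset.univ.filter fun j : Fin n => j < i ∧ 0 < π j).card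
  else (Finset.univ.filter fun j : Fin n => j < i ∧ |π j| ≠ |π i|).card

/-!
For any stationary repair scheme, the smallest minimum cut over all failure histories equals the
smallest value, over all orderings `ρ` of the nodes, of the sum over the first `k` nodes of
`min (r * β) α`, where `r` counts the helpers of the node that do not precede it in `ρ`
(`orderCost`).

* *Every cut costs at least as much as some ordering* (`exists_orderCost_le_cutValue`). A node may
  fail repeatedly, so several of its copies can lie on the collector's side of the cut. Only the
  first such copy of each node is charged, and the nodes are sorted by the time at which this copy
  appears. When the first copy of a node is created, the active copies of the nodes that do not
  come earlier in this order are still on the source's side, so either the storage edge of the new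
  copy or its edges from these helpers are cut.
* *Every ordering is realised* (`exists_minCut_le_orderCost`) by the history in which its first `k`
  nodes fail once each, in this order, with a collector that contacts exactly these nodes.

For the family repair scheme, membership in a helper set can be read off the family indices
(`mem_familyHelpers_iff`), so the helpers of a node that precede it in the ordering are exactly the
entries counted by `yCount`; the orderings then correspond to the family index permutations.
-/

/-! ### Flow into a vertex -/

namespace FlowNetwork

variable {V : Type*} [Fintype V] [DecidableEq V]

theorem cutValue_eq_sum_compl (N : FlowNetwork V) (U : Finset V) :
    N.cutValue U = ∑ v ∈ Uᶜ, ∑ u ∈ U, N.cap u v :=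
  Finset.sum_comm

theorem cap_le_cutValue (N : FlowNetwork V) {U : Finset V} {u v : V} (hu : u ∈ U) (hv : v ∉ U) :
    N.cap u v ≤ N.cutValue U :=
  (Finset.single_le_sum (f := fun v => N.cap u v) (fun _ _ => zero_le)
    (Finset.mem_compl.2 hv)).trans
    (Finset.single_le_sum (f := fun u => ∑ v ∈ Uᶜ, N.cap u v) (fun _ _ => zero_le) hu)

end FlowNetwork

/-! ### Copies of a node -/

section Copies

variable {n T : ℕ} (f : Fin T → Fin n)

/-- The node of which a vertex of the information flow graph is a copy; `none` for the source and
the collectors. -/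
def nodeLabel {k : ℕ} : IFGVertex n k T → Option (Fin n)
  | .inp x => some (Sum.elim id f x)
  | .out x => some (Sum.elim id f x)
  | _ => none

theorem elim_activeNode (t : ℕ) (h : t ≤ T) (i : Fin n) :
    Sum.elim id f (activeNode f t h i) = i := by
  induction t with
  | zero => rfl
  | succ t ih =>
    unfold activeNode
    split_ifs with h1
    · exact h1
    · exact ih _

theorem activeNode_injective (t : ℕ) (h : t ≤ T) : Function.Injective (activeNode f t h) :=
  (show Function.LeftInverse (Sum.elim id f) (activeNode f t h) from
    elim_activeNode f t h).injective

theorem ne_of_activeNode_eq_inl {t : ℕ} {h : t ≤ T} {i i' : Fin n}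
    (hi : activeNode f t h i = Sum.inl i') (j : Fin T) (hj : (j : ℕ) < t) : f j ≠ i := by
  induction t with
  | zero => omega
  | succ t ih =>
    unfold activeNode at hi
    split_ifs at hi with h1
    rcases Nat.lt_succ_iff_lt_or_eq.1 hj with h2 | h2
    · exact ih hi h2
    · have : j = ⟨t, h⟩ := Fin.ext h2
      rwa [this]

end Copies

/-! ### The cost of an ordering of the nodes -/

section OrderCost

variable {n d : ℕ} (A : StationaryScheme n d)

/-- The number of helpers of the `i`-th node of the ordering `ρ` that do not precede it in `ρ`. -/
def laterHelperCount (ρ : Equiv.Perm (Fin n)) (i : Fin n) : ℕ :=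
  (Finset.univ.filter fun j : Fin n => i ≤ j ∧ ρ j ∈ A.helpers (ρ i)).card

/-- The cost of an ordering of the nodes: each of its first `k` nodes contributes the smaller of
its storage and the traffic from those of its helpers that do not precede it. -/
noncomputable def orderCost (k : ℕ) (α β : ℝ≥0) (ρ : Equiv.Perm (Fin n)) : ℝ≥0 :=
  ∑ i ∈ Finset.univ.filter (fun i : Fin n => (i : ℕ) < k),
    min ((laterHelperCount A ρ i : ℝ≥0) * β) α

theorem earlier_add_laterHelperCount (ρ : Equiv.Perm (Fin n)) (i : Fin n) :
    (Finset.univ.filter fun j : Fin n => j < i ∧ ρ j ∈ A.helpers (ρ i)).card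
      + laterHelperCount A ρ i = d := by
  have h1 : (Finset.univ.filter fun j : Fin n => ρ j ∈ A.helpers (ρ i)).card = d := by
    refine Eq.trans ?_ (A.card_helpers (ρ i))
    rw [← Finset.card_map ρ.toEmbedding]
    congr 1
    ext h
    simp
  have h2 := Finset.card_filter_add_card_filter_not
    (s := Finset.univ.filter fun j : Fin n => ρ j ∈ A.helpers (ρ i)) (fun j => j < i)
  simp only [Finset.filter_filter, not_lt, and_comm (a := ρ _ ∈ A.helpers (ρ i))] at h2
  exact h2.trans h1

end OrderCost

/-! ### Every cut costs at least as much as some ordering -/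

section LowerBound

variable {n d k T : ℕ} (A : StationaryScheme n d) (α β : ℝ≥0) (f : Fin T → Fin n)

/-- A node `i` whose copy at time `t` is its first one outside `U` forces a vertex outside `U` that
receives at least `min (r.card * β) α` from `U`, for any set `r` of helpers of `i` that have had no
copy outside `U` before time `t`: either its input is in `U` and its storage edge is cut, or its
input is outside `U` and receives all the edges from `r`. -/
theorem exists_inflow_ge {U : Finset (IFGVertex n k T)} (hs : IFGVertex.source ∈ U)
    (hfin : (ifg A k α β f).cutValue U ≠ ⊤) {i : Fin n} {t : ℕ} (ht : t ≤ T)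
    (hout : IFGVertex.out (activeNode f t ht i) ∉ U)
    (hbefore : ∀ (t' : ℕ) (h' : t' ≤ T), t' < t → IFGVertex.out (activeNode f t' h' i) ∈ U)
    {r : Finset (Fin n)} (hr : r ⊆ A.helpers i)
    (hrU : ∀ h ∈ r, ∀ (t' : ℕ) (h' : t' ≤ T), t' < t →
      IFGVertex.out (activeNode f t' h' h) ∈ U) :
    ∃ v ∉ U, nodeLabel f v = some i ∧
      min ((r.card : ℝ≥0∞) * β) α ≤ ∑ u ∈ U, (ifg A k α β f).cap u v := by
  by_cases hin : IFGVertex.inp (activeNode f t ht i) ∈ U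
  · refine ⟨_, hout, by simp [nodeLabel, elim_activeNode], (min_le_right _ _).trans ?_⟩
    refine le_trans ?_ (Finset.single_le_sum (fun _ _ => zero_le) hin)
    simp [ifg]
  · refine ⟨_, hin, by simp [nodeLabel, elim_activeNode], (min_le_left _ _).trans ?_⟩
    cases t with
    | zero =>
      -- The input of an initial copy is fed by the source through an edge of infinite capacity.
      refine absurd (top_le_iff.1 (le_trans ?_ (FlowNetwork.cap_le_cutValue _ hs hin))) hfin
      simp [ifg, activeNode]
    | succ t =>
      have hprev := hbefore t (Nat.le_of_succ_le ht) t.lt_succ_self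
      -- The copy has changed sides at time `t`, so it is the newcomer of that time.
      have hft : f ⟨t, ht⟩ = i := by
        by_contra hne
        exact hout (by simpa [activeNode, hne] using hprev)
      have hact : activeNode f (t + 1) ht i = Sum.inr ⟨t, ht⟩ := by simp [activeNode, hft]
      rw [hact]
      have hinj : Set.InjOn (fun h => (IFGVertex.out (activeNode f t (Nat.le_of_succ_le ht) h) :
          IFGVertex n k T)) r := by
        intro a _ b _ hab
        exact activeNode_injective f t _ (IFGVertex.out.inj hab)
      calc (r.card : ℝ≥0∞) * β = ∑ h ∈ r, (ifg A k α β f).cap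
            (.out (activeNode f t (Nat.le_of_succ_le ht) h)) (.inp (.inr ⟨t, ht⟩)) := by
            rw [← nsmul_eq_mul, ← Finset.sum_const]
            refine Finset.sum_congr rfl fun h hh => ?_
            have : ∃ i ∈ A.helpers (f ⟨t, ht⟩), activeNode f t (Nat.le_of_succ_le ht) h
                = activeNode f t (Nat.le_of_succ_le ht) i := ⟨h, by rw [hft]; exact hr hh, rfl⟩
            simp only [ifg]
            rw [if_pos this]
        _ = ∑ u ∈ r.image fun h => IFGVertex.out (activeNode f t (Nat.le_of_succ_le ht) h),
              (ifg A k α β f).cap u (.inp (.inr ⟨t, ht⟩)) :=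
            (Finset.sum_image
              (f := fun u => (ifg A k α β f).cap u (.inp (.inr ⟨t, ht⟩))) hinj).symm
        _ ≤ _ := by
            refine Finset.sum_le_sum_of_subset fun u hu => ?_
            obtain ⟨h, hh, rfl⟩ := Finset.mem_image.1 hu
            exact hrU h hh t _ t.lt_succ_self

theorem exists_orderCost_le_cutValue (S : {S : Finset (Fin n) // S.card = k})
    {U : Finset (IFGVertex n k T)} (hs : IFGVertex.source ∈ U)
    (ht : IFGVertex.collector S ∉ U) :
    ∃ ρ : Equiv.Perm (Fin n),
      (orderCost A k α β ρ : ℝ≥0∞) ≤ (ifg A k α β f).cutValue U := by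
  classical
  by_cases hfin : (ifg A k α β f).cutValue U = ⊤
  · exact ⟨1, by rw [hfin]; exact le_top⟩
  -- The first time at which a copy of `i` is outside `U`; the value `T + 1` means never.
  have hex : ∀ i : Fin n, ∃ t, t = T + 1 ∨
      ∃ h : t ≤ T, (IFGVertex.out (activeNode f t h i) : IFGVertex n k T) ∉ U :=
    fun _ => ⟨T + 1, Or.inl rfl⟩
  let key : Fin n → ℕ := fun i => Nat.find (hex i)
  have hkey_le : ∀ {i t} (h : t ≤ T),
      (IFGVertex.out (activeNode f t h i) : IFGVertex n k T) ∉ U → key i ≤ t :=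
    fun h hU => Nat.find_min' (hex _) (Or.inr ⟨h, hU⟩)
  have hbefore : ∀ (i : Fin n) (t' : ℕ) (h' : t' ≤ T), t' < key i →
      (IFGVertex.out (activeNode f t' h' i) : IFGVertex n k T) ∈ U := by
    intro i t' h' hlt
    by_contra hU
    exact absurd (hkey_le h' hU) (not_le.2 hlt)
  have hout : ∀ (i : Fin n) (h : key i ≤ T),
      (IFGVertex.out (activeNode f (key i) h i) : IFGVertex n k T) ∉ U := by
    intro i h
    rcases Nat.find_spec (hex i) with h1 | ⟨_, h1⟩
    · exact absurd (show key i = T + 1 from h1) (by omega)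
    · exact h1
  have hS : ∀ i ∈ S.1, key i ≤ T := by
    intro i hi
    refine hkey_le le_rfl fun hU => hfin (top_le_iff.1 ?_)
    refine le_trans ?_ (FlowNetwork.cap_le_cutValue _ hU ht)
    have : ∃ i' ∈ S.1, activeNode f T le_rfl i = activeNode f T le_rfl i' := ⟨i, hi, rfl⟩
    simp only [ifg]
    rw [if_pos this]
  let ρ : Equiv.Perm (Fin n) := Tuple.sort key
  have hmono : Monotone (key ∘ ρ) := Tuple.monotone_sort key
  -- If the key of `ρ i` exceeded `T`, all `k` nodes of `S` would be among the `i` nodes before it.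
  have hfirst : ∀ i : Fin n, (i : ℕ) < k → key (ρ i) ≤ T := by
    intro i hi
    by_contra hgt
    have hsub : S.1 ⊆ (Finset.Iio i).map ρ.toEmbedding := by
      intro s hsS
      have hlt : ρ.symm s < i := by
        by_contra hle
        have h1 := hmono (not_lt.1 hle)
        have h2 := hS s hsS
        simp only [Function.comp_apply, Equiv.apply_symm_apply] at h1
        omega
      exact Finset.mem_map.2 ⟨ρ.symm s, Finset.mem_Iio.2 hlt, by simp⟩
    have h3 := Finset.card_le_card hsub
    rw [S.2, Finset.card_map, Fin.card_Iio] at h3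
    omega
  refine ⟨ρ, ?_⟩
  have hv : ∀ i : Fin n, (i : ℕ) < k → ∃ v ∉ U, nodeLabel f v = some (ρ i) ∧
      min ((laterHelperCount A ρ i : ℝ≥0∞) * β) α ≤ ∑ u ∈ U, (ifg A k α β f).cap u v := by
    intro i hi
    have h1 := exists_inflow_ge A α β f hs hfin (hfirst i hi) (hout _ _) (hbefore _)
      (r := (Finset.univ.filter fun j : Fin n =>
        i ≤ j ∧ ρ j ∈ A.helpers (ρ i)).map ρ.toEmbedding)
      (by
        intro h hh
        obtain ⟨j, hj, rfl⟩ := Finset.mem_map.1 hh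
        exact (Finset.mem_filter.1 hj).2.2)
      (by
        intro h hh t' h' hlt
        obtain ⟨j, hj, rfl⟩ := Finset.mem_map.1 hh
        exact hbefore _ _ _ (hlt.trans_le (hmono (Finset.mem_filter.1 hj).2.1)))
    rwa [Finset.card_map] at h1
  have : Nonempty (IFGVertex n k T) := ⟨.source⟩
  choose! v hvU hvl hvc using hv
  have hinj : Set.InjOn v ((Finset.univ.filter fun i : Fin n => (i : ℕ) < k : Finset (Fin n)) :
      Set (Fin n)) := by
    intro a ha b hb hab
    have ha' := hvl a (by simpa using ha)
    rw [hab, hvl b (by simpa using hb)] at ha'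
    exact ρ.injective (Option.some.inj ha'.symm)
  rw [FlowNetwork.cutValue_eq_sum_compl]
  calc (orderCost A k α β ρ : ℝ≥0∞)
      = ∑ i ∈ Finset.univ.filter (fun i : Fin n => (i : ℕ) < k),
          min ((laterHelperCount A ρ i : ℝ≥0∞) * β) α := by
        simp [orderCost]
    _ ≤ ∑ i ∈ Finset.univ.filter (fun i : Fin n => (i : ℕ) < k),
          ∑ u ∈ U, (ifg A k α β f).cap u (v i) :=
        Finset.sum_le_sum fun i hi => hvc i (Finset.mem_filter.1 hi).2
    _ = ∑ w ∈ (Finset.univ.filter (fun i : Fin n => (i : ℕ) < k)).image v,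
          ∑ u ∈ U, (ifg A k α β f).cap u w :=
        (Finset.sum_image (f := fun w => ∑ u ∈ U, (ifg A k α β f).cap u w) hinj).symm
    _ ≤ _ := by
        refine Finset.sum_le_sum_of_subset fun w hw => ?_
        obtain ⟨i, hi, rfl⟩ := Finset.mem_image.1 hw
        exact Finset.mem_compl.2 (hvU i (Finset.mem_filter.1 hi).2)

end LowerBound

/-! ### Every ordering is realised by a failure history -/

theorem exists_minCut_le_orderCost {n d k : ℕ} (A : StationaryScheme n d) (hkn : k ≤ n)
    (α β : ℝ≥0) (ρ : Equiv.Perm (Fin n)) :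
    ∃ (T : ℕ) (f : Fin T → Fin n) (S : {S : Finset (Fin n) // S.card = k}),
      (ifg A k α β f).minCut .source (.collector S) ≤ (orderCost A k α β ρ : ℝ≥0∞) := by
  classical
  let f : Fin k → Fin n := fun j => ρ (Fin.castLE hkn j)
  let e : Fin k ↪ Fin n := (Fin.castLEEmb hkn).trans ρ.toEmbedding
  let S : {S : Finset (Fin n) // S.card = k} := ⟨Finset.univ.map e, by simp⟩
  let cheap : Finset (Fin k) := Finset.univ.filter fun j =>
    (laterHelperCount A ρ (Fin.castLE hkn j) : ℝ≥0) * β ≤ α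
  -- The collector's side: besides the collector, all newcomers' outputs, and the inputs of those
  -- newcomers for which cutting the helper edges is cheaper than cutting the storage edge.
  let W : Finset (IFGVertex n k k) := {.collector S} ∪
    ((Finset.univ.image fun j : Fin k => .out (.inr j)) ∪ (cheap.image fun j => .inp (.inr j)))
  have houtW : ∀ j : Fin k, IFGVertex.out (.inr j) ∈ W := fun j => by simp [W]
  have hinW : ∀ j ∈ cheap, IFGVertex.inp (.inr j) ∈ W := fun j hj => by simp [W, hj]
  refine ⟨k, f, S, ?_⟩
  refine (iInf_le _ ⟨Wᶜ, by simp [W], by simp [W]⟩).trans ?_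
  rw [FlowNetwork.cutValue_eq_sum_compl, compl_compl]
  set N := ifg A k α β f with hN
  have hcoll : ∑ u ∈ Wᶜ, N.cap u (.collector S) = 0 := by
    refine Finset.sum_eq_zero fun u hu => ?_
    cases u with
    | out x =>
      have hx : ¬ ∃ i ∈ S.1, x = activeNode f k le_rfl i := by
        rintro ⟨i, hi, rfl⟩
        obtain ⟨j, -, rfl⟩ := Finset.mem_map.1 hi
        cases hact : activeNode f k le_rfl (e j) with
        | inl i' => exact ne_of_activeNode_eq_inl f hact j j.isLt rfl
        | inr j' => exact Finset.mem_compl.1 hu (hact ▸ houtW j')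
      simp only [hN, ifg]
      rw [if_neg hx]
    | _ => simp [hN, ifg]
  have hout : ∀ j : Fin k,
      ∑ u ∈ Wᶜ, N.cap u (.out (.inr j)) ≤ if j ∈ cheap then 0 else (α : ℝ≥0∞) := by
    intro j
    calc _ ≤ ∑ u ∈ ({.inp (.inr j)} : Finset (IFGVertex n k k)) \ W,
            N.cap u (.out (.inr j)) := by
          refine Finset.sum_le_sum_of_ne_zero fun u hu hne => ?_
          cases u with
          | inp x =>
            have hx : x = .inr j := by
              by_contra hx
              exact hne (by simp [hN, ifg, hx])
            subst hx
            exact Finset.mem_sdiff.2 ⟨Finset.mem_singleton_self _, Finset.mem_compl.1 hu⟩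
          | _ => simp [hN, ifg] at hne
      _ ≤ _ := by
          split_ifs with hj
          · rw [Finset.sdiff_eq_empty_iff_subset.2
              (Finset.singleton_subset_iff.2 (hinW j hj)), Finset.sum_empty]
          · refine (Finset.sum_le_sum_of_subset Finset.sdiff_subset).trans ?_
            simp [hN, ifg]
  have hin : ∀ j : Fin k, ∑ u ∈ Wᶜ, N.cap u (.inp (.inr j))
      ≤ (laterHelperCount A ρ (Fin.castLE hkn j) : ℝ≥0∞) * β := by
    intro j
    let R : Finset (Fin n) := Finset.univ.filter fun i : Fin n =>
      Fin.castLE hkn j ≤ i ∧ ρ i ∈ A.helpers (ρ (Fin.castLE hkn j))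
    calc _ ≤ ∑ u ∈ R.image fun i => (IFGVertex.out (.inl (ρ i)) : IFGVertex n k k),
            N.cap u (.inp (.inr j)) := by
          refine Finset.sum_le_sum_of_ne_zero fun u hu hne => ?_
          cases u with
          | out x =>
            cases x with
            | inr j' => exact absurd (houtW j') (Finset.mem_compl.1 hu)
            | inl i =>
              have hx : ∃ h ∈ A.helpers (f j),
                  (Sum.inl i : Fin n ⊕ Fin k) = activeNode f j j.isLt.le h := by
                by_contra hx
                refine hne ?_
                simp only [hN, ifg]
                rw [if_neg hx]
              obtain ⟨h, hh, hact⟩ := hx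
              have hih : i = h := by
                have := elim_activeNode f j j.isLt.le h
                rwa [← hact] at this
              subst hih
              refine Finset.mem_image.2 ⟨ρ.symm i, Finset.mem_filter.2 ⟨Finset.mem_univ _, ?_, ?_⟩,
                by simp⟩
              · by_contra hlt
                have hlt' : ((ρ.symm i : Fin n) : ℕ) < j := by
                  simpa [Fin.lt_def] using hlt
                refine ne_of_activeNode_eq_inl f hact.symm ⟨ρ.symm i, hlt'.trans j.isLt⟩ hlt' ?_
                exact ρ.apply_symm_apply i
              · simpa using hh
          | _ => simp [hN, ifg] at hne
      _ ≤ ∑ u ∈ R.image fun i => (IFGVertex.out (.inl (ρ i)) : IFGVertex n k k), (β : ℝ≥0∞) := by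
          refine Finset.sum_le_sum fun u hu => ?_
          obtain ⟨i, -, rfl⟩ := Finset.mem_image.1 hu
          simp only [hN, ifg]
          split_ifs <;> simp
      _ ≤ _ := by
          rw [Finset.sum_const, nsmul_eq_mul]
          gcongr
          exact Finset.card_image_le
  have hreindex : (orderCost A k α β ρ : ℝ≥0∞) = ∑ j : Fin k,
      min ((laterHelperCount A ρ (Fin.castLE hkn j) : ℝ≥0∞) * β) α := by
    have hmap : Finset.univ.filter (fun i : Fin n => (i : ℕ) < k)
        = Finset.univ.map (Fin.castLEEmb hkn) := by
      ext i
      simp only [Finset.mem_filter, Finset.mem_univ, true_and, Finset.mem_map]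
      exact ⟨fun hi => ⟨⟨i, hi⟩, rfl⟩, by rintro ⟨j, rfl⟩; exact j.isLt⟩
    simp [orderCost, hmap]
  calc ∑ v ∈ W, ∑ u ∈ Wᶜ, N.cap u v
      = ∑ u ∈ Wᶜ, N.cap u (.collector S) + (∑ j : Fin k, ∑ u ∈ Wᶜ, N.cap u (.out (.inr j))
          + ∑ j ∈ cheap, ∑ u ∈ Wᶜ, N.cap u (.inp (.inr j))) := by
        rw [Finset.sum_union (by simp), Finset.sum_union (by
            simp only [Finset.disjoint_left, Finset.mem_image]
            rintro _ ⟨j, -, rfl⟩ ⟨j', -, h⟩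
            cases h), Finset.sum_singleton,
          Finset.sum_image (by rintro a - b - h; cases h; rfl),
          Finset.sum_image (by rintro a - b - h; cases h; rfl)]
    _ ≤ ∑ j : Fin k, ((if j ∈ cheap then 0 else (α : ℝ≥0∞)) +
          if j ∈ cheap then (laterHelperCount A ρ (Fin.castLE hkn j) : ℝ≥0∞) * β else 0) := by
        rw [hcoll, zero_add, Finset.sum_add_distrib, ← Finset.sum_filter,
          Finset.filter_mem_eq_inter, Finset.univ_inter]
        exact add_le_add (Finset.sum_le_sum fun j _ => hout j)
          (Finset.sum_le_sum fun j _ => hin j)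
    _ ≤ _ := by
        rw [hreindex]
        refine Finset.sum_le_sum fun j _ => ?_
        split_ifs with hj
        · have hj' := (Finset.mem_filter.1 hj).2
          rw [zero_add, le_min_iff]
          exact ⟨le_rfl, by exact_mod_cast hj'⟩
        · have hj' : α ≤ (laterHelperCount A ρ (Fin.castLE hkn j) : ℝ≥0) * β := by
            simp only [cheap, Finset.mem_filter, Finset.mem_univ, true_and, not_le] at hj
            exact hj.le
          rw [add_zero, le_min_iff]
          exact ⟨by exact_mod_cast hj', le_rfl⟩

/-! ### Family indices and helper sets -/

section FamilyIndex

variable {n d : ℕ}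

/-- The helpers `0, …, d - 1` of a member of the incomplete family are exactly the positions of
positive family index. -/
theorem familyIndexVector_pos_iff (q : Fin n) : 0 < familyIndexVector n d q ↔ (q : ℕ) < d := by
  unfold familyIndexVector
  split_ifs with h1 h2
  · simp only [h1, iff_true]; positivity
  · simp only [h1, iff_false, not_lt, Left.neg_nonpos_iff]; positivity
  · simp [h1]

theorem abs_familyIndexVector (hd : d < n) (p : Fin n) :
    |familyIndexVector n d p| =
      if (p : ℕ) / (n - d) < n / (n - d) then (((p : ℕ) / (n - d) + 1 : ℕ) : ℤ) else 0 := by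
  have hm : 0 < n - d := by omega
  have hlast : n / (n - d) = d / (n - d) + 1 := by
    rw [← Nat.add_div_right d hm, Nat.add_sub_cancel' hd.le]
  have hlt : (p : ℕ) / (n - d) < n / (n - d) ↔ (p : ℕ) < n / (n - d) * (n - d) :=
    Nat.div_lt_iff_lt_mul hm
  unfold familyIndexVector
  split_ifs with h1 h2 h3 h4 h5
  · exact abs_of_nonneg (by positivity)
  · have := Nat.div_le_div_right (c := n - d) h1.le
    omega
  · -- A position of a complete family outside the first `d` positions is in the last one.
    have := Nat.div_le_div_right (c := n - d) (not_lt.1 h1)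
    rw [abs_neg, abs_of_nonneg (by positivity)]
    norm_cast
    omega
  · exact absurd (hlt.2 h3) h4
  · exact absurd (hlt.1 h5) h3
  · simp

theorem mem_familyHelpers_iff (hd : d < n) (p q : Fin n) :
    q ∈ familyHelpers n d p ↔
      if familyIndexVector n d p = 0 then 0 < familyIndexVector n d q
      else |familyIndexVector n d q| ≠ |familyIndexVector n d p| := by
  simp only [← abs_eq_zero (a := familyIndexVector n d p), familyIndexVector_pos_iff,
    abs_familyIndexVector hd]
  unfold familyHelpers
  by_cases hp : (p : ℕ) / (n - d) < n / (n - d)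
  · have hne : (((p : ℕ) / (n - d) + 1 : ℕ) : ℤ) ≠ 0 := by positivity
    simp only [if_pos hp, if_neg hne, Finset.mem_filter, Finset.mem_univ, true_and]
    split_ifs with hq <;> omega
  · simp [if_neg hp]

theorem yCount_add_laterHelperCount (hd : d < n) (σ ρ : Equiv.Perm (Fin n)) (i : Fin n) :
    yCount (familyIndexVector n d ∘ ρ.trans σ) i
      + laterHelperCount (familyRepair hd σ) ρ i = d := by
  refine Eq.trans ?_ (earlier_add_laterHelperCount (familyRepair hd σ) ρ i)
  congr 1
  have hmem : ∀ j, ρ j ∈ (familyRepair hd σ).helpers (ρ i) ↔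
      σ (ρ j) ∈ familyHelpers n d (σ (ρ i)) := by
    intro j
    simp [familyRepair]
  unfold yCount
  split_ifs with h
  · refine congrArg Finset.card (Finset.filter_congr fun j _ => and_congr_right fun _ => ?_)
    rw [hmem, mem_familyHelpers_iff hd]
    exact (iff_of_eq (if_pos h)).symm
  · refine congrArg Finset.card (Finset.filter_congr fun j _ => and_congr_right fun _ => ?_)
    rw [hmem, mem_familyHelpers_iff hd]
    exact (iff_of_eq (if_neg h)).symm

theorem coe_orderCost_familyRepair (hd : d < n) (k : ℕ) (α β : ℝ≥0) (σ ρ : Equiv.Perm (Fin n)) :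
    (orderCost (familyRepair hd σ) k α β ρ : ℝ) =
      ∑ i ∈ Finset.univ.filter (fun i : Fin n => (i : ℕ) < k),
        min (((d : ℝ) - (yCount (familyIndexVector n d ∘ ρ.trans σ) i : ℝ)) * (β : ℝ))
          (α : ℝ) := by
  unfold orderCost
  push_cast
  refine Finset.sum_congr rfl fun i _ => ?_
  have h : (yCount (familyIndexVector n d ∘ ρ.trans σ) i : ℝ)
      + laterHelperCount (familyRepair hd σ) ρ i = d := by
    exact_mod_cast yCount_add_laterHelperCount hd σ ρ i
  rw [← h, add_sub_cancel_left]

end FamilyIndex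

theorem proposition3 (n k d : ℕ) (hk : 1 ≤ k) (hkn : k ≤ n) (hd : 1 ≤ d) (hdn : d < n)
    (α β : ℝ≥0) (σ : Equiv.Perm (Fin n)) :
    ∃ m : ℝ≥0,
      IsLeast {v : ℝ≥0∞ | ∃ (T : ℕ) (f : Fin T → Fin n) (S : {S : Finset (Fin n) // S.card = k}),
        v = (ifg (familyRepair hdn σ) k α β f).minCut .source (.collector S)} (m : ℝ≥0∞) ∧
      IsLeast {v : ℝ | ∃ π : Fin n → ℤ, IsFamilyIndexPermutation n d π ∧
        v = ∑ i ∈ Finset.univ.filter (fun i : Fin n => (i : ℕ) < k),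
          min (((d : ℝ) - (yCount π i : ℝ)) * (β : ℝ)) (α : ℝ)} (m : ℝ) := by
  obtain ⟨ρ₀, hρ₀⟩ := Finite.exists_min (orderCost (familyRepair hdn σ) k α β)
  have hlower : ∀ (T : ℕ) (f : Fin T → Fin n) (S : {S : Finset (Fin n) // S.card = k}),
      (orderCost (familyRepair hdn σ) k α β ρ₀ : ℝ≥0∞)
        ≤ (ifg (familyRepair hdn σ) k α β f).minCut .source (.collector S) := by
    intro T f S
    refine le_iInf fun U => ?_
    obtain ⟨ρ, hρ⟩ := exists_orderCost_le_cutValue (familyRepair hdn σ) α β f S U.2.1 U.2.2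
    exact le_trans (by exact_mod_cast hρ₀ ρ) hρ
  refine ⟨orderCost (familyRepair hdn σ) k α β ρ₀, ⟨?_, ?_⟩, ⟨?_, ?_⟩⟩
  · obtain ⟨T, f, S, h⟩ := exists_minCut_le_orderCost (familyRepair hdn σ) hkn α β ρ₀
    exact ⟨T, f, S, le_antisymm (hlower T f S) h⟩
  · rintro v ⟨T, f, S, rfl⟩
    exact hlower T f S
  · exact ⟨_, ⟨ρ₀.trans σ, rfl⟩, coe_orderCost_familyRepair hdn k α β σ ρ₀⟩
  · rintro v ⟨π, ⟨τ, rfl⟩, rfl⟩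
    have h := coe_orderCost_familyRepair hdn k α β σ (τ.trans σ.symm)
    rw [Equiv.trans_assoc, Equiv.symm_trans_self, Equiv.trans_refl] at h
    rw [← h]
    exact_mod_cast hρ₀ _
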